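/- **Definitions.** Let $m\in\mathbb N$. An *$m$-discrete OCS* is a randomized online algorithm on a finite ground set which at each time step $j=1,2,\dots$ is given a size-$m$ multiset $A_j$ of ground elements and irrevocably selects one winner from $A_j$ (depending only on $A_1,\dots,A_j$ and on its random seed). For $F:\mathbb Z_{\ge 0}\to[0,1]$, it is an *$(F,m)$-discrete OCS* if, for every sequence $A_1,A_2,\dots$, every element $i$ and all pairwise disjoint sets of consecutive time steps $S_1,\dots,S_k$ (each of the form $\{j_1,\dots,j_2\}$ with $j_1<j_2$), the probability that $i$ never wins at a time step in $S_1\cup\dots\cup S_k$ is at most $\prod_{\ell=1}^k F(\mathrm{count}_i(S_\ell))$, where $\mathrm{count}_i(S)$ is the number of times, with multiplicity, that $i$ appears in the multisets $A_j$, $j\in S$. "There is an $(F,m)$-discrete OCS" means that there is one on every finite ground set. In *edge-weighted online bipartite matching* (with free disposal) the finite set $L$ of offline vertices is known at the start. Online vertices $j$ arrive one by one, each revealing its weights $w_{ij}\ge 0$, $i\in L$ ($w_{ij}=0$ meaning that there is no edge), and each must irrevocably be matched to an offline neighbour or left unmatched before the next one arrives. Several online vertices may be matched to the same $i\in L$,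 but $i$ then contributes only the largest of their weights (and $0$ if there are none). A randomized online algorithm is *$\Gamma$-competitive* if on every instance its expected total weight is at least $\Gamma$ times the optimal total weight with hindsight. "There is a $\Gamma$-competitive algorithm" means that there is one for every finite $L$. For $F:\mathbb Z_{\ge0}\to\mathbb R$ let $(\Delta F)(n)=F(n+1)-F(n)$, and let $\Delta^{(\ell)}$ be the $\ell$-fold iterate of $\Delta$. **Lemma.** Let $m,k^\star\in\mathbb N$ (zero allowed), $c\in[0,1]$, and let $F:\mathbb Z_{\ge0}\to[0,1]$ be log-concave, i.e. $F(k)F(k+2)\le F(k+1)^2$ for all $k\ge 0$. Suppose that $$F(k)=F(k^\star)(1-c)^{k-k^\star}\qquad\text{for all }k\ge k^\star,$$ that $\Delta^{(2)}F(k)\ge 0$ for all $k<k^\star$, that $$\Delta^{(3)}F(k_1)\,\Delta F(k_2)+\Delta F(k_1)\,\Delta^{(3)}F(k_2)\le 2\,\Delta^{(2)}F(k_1)\,\Delta^{(2)}F(k_2)\qquad\text{for all }k_1,k_2<k^\star,$$ and that $$\Delta^{(3)}F(k)+2c\,\Delta^{(2)}F(k)+c^2\,\Delta F(k)\ge 0\qquad\text{for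 all }k<k^\star.$$ Let $$\Gamma:=1-\left(\sum_{n=0}^{k^\star-1}\frac{m^n}{(m+1)^{n+1}}F(n)\right)-\left(\frac{m}{m+1}\right)^{k^\star}\cdot\frac{1}{1+mc}\cdot F(k^\star),$$ and suppose that $$m\le\frac{-m\,\Delta F(0)-\Gamma}{\Gamma+(1-\Gamma)\,m\,\Delta F(0)},$$ where the bound is understood to impose no restriction if the denominator is $0$. If there is an $(F,m)$-discrete OCS, then there is a $\Gamma$-competitive algorithm for edge-weighted online bipartite matching. -/

import Mathlib

open MeasureTheory
open scoped NNReal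

/-- A (randomized) `m`-discrete OCS on the ground set `L`, with random seed in `Ω`: an online
algorithm which at every time step `j = 0, 1, 2, …` has seen the size-`m` multisets of the steps
`0, …, j` (and nothing else) and selects a winner out of the last of them. -/
structure DiscreteOCS (m : ℕ) (L : Type) (Ω : Type) [MeasurableSpace Ω] where
  /-- The winner of step `j`, given the multisets of the steps `0, …, j` and the seed. -/
  winner : (j : ℕ) → (Fin (j + 1) → Sym L m) → Ω → L
  winner_mem : ∀ (j : ℕ) (A : Fin (j + 1) → Sym L m) (ω : Ω), winner j A ω ∈ A (Fin.last j)
  measurableSet_winner : ∀ (j : ℕ) (A : Fin (j + 1) → Sym L m) (i : L),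
    MeasurableSet {ω | winner j A ω = i}

namespace DiscreteOCS

variable {m : ℕ} {L Ω : Type} [MeasurableSpace Ω]

/-- The winner of step `j` when the OCS is run on the stream of multisets `A 0, A 1, A 2, …`. -/
def run (O : DiscreteOCS m L Ω) (A : ℕ → Sym L m) (j : ℕ) (ω : Ω) : L :=
  O.winner j (fun k => A k) ω

/-- The guarantee of an `(F, m)`-discrete OCS: on every stream of multisets, for every element `i`
and all pairwise disjoint sets of consecutive time steps `S ℓ = {a ℓ, …, b ℓ}` with `a ℓ < b ℓ`,
the probability that `i` wins at no time step of `⋃ ℓ, S ℓ` is at most the product of the numbers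
`F (count_i (S ℓ))`, where `count_i (S ℓ)` is the number of times, with multiplicity, that `i`
appears in the multisets of the time steps in `S ℓ`. -/
def HasGuarantee [DecidableEq L] (O : DiscreteOCS m L Ω) (μ : Measure Ω) (F : ℕ → ℝ) : Prop :=
  ∀ (A : ℕ → Sym L m) (i : L) (k : ℕ) (a b : Fin k → ℕ),
    (∀ ℓ, a ℓ < b ℓ) →
    (∀ ℓ ℓ', ℓ ≠ ℓ' → Disjoint (Finset.Icc (a ℓ) (b ℓ)) (Finset.Icc (a ℓ') (b ℓ'))) →
    μ.real {ω | ∀ ℓ, ∀ j ∈ Finset.Icc (a ℓ) (b ℓ), O.run A j ω ≠ i} ≤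
      ∏ ℓ, F (∑ j ∈ Finset.Icc (a ℓ) (b ℓ), Multiset.count i (A j : Multiset L))

end DiscreteOCS

/-- There is an `(F, m)`-discrete OCS: on every finite ground set there is a randomized
`m`-discrete OCS with the guarantee given by `F`. -/
def ExistsDiscreteOCS (F : ℕ → ℝ) (m : ℕ) : Prop :=
  ∀ (L : Type) [Fintype L] [DecidableEq L],
    ∃ (Ω : Type) (_ : MeasurableSpace Ω) (μ : Measure Ω) (_ : IsProbabilityMeasure μ)
      (O : DiscreteOCS m L Ω), O.HasGuarantee μ F

/-- A (randomized) algorithm for edge-weighted online bipartite matching with offline vertices `L`,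
with random seed in `Ω`. When the online vertex `j = 0, 1, 2, …` arrives, the algorithm has seen the
weights `w k i` of the online vertices `k = 0, …, j` (weight `0` means that there is no edge), and
it matches `j` to an offline neighbour or leaves it unmatched. An offline vertex may be used more
than once (free disposal). -/
structure OnlineMatching (L : Type) (Ω : Type) [MeasurableSpace Ω] where
  /-- The partner of the online vertex `j`, given the weights so far and the seed. -/
  partner : (j : ℕ) → (Fin (j + 1) → L → ℝ≥0) → Ω → Option L
  edge : ∀ (j : ℕ) (w : Fin (j + 1) → L → ℝ≥0) (ω : Ω) (i : L),
    partner j w ω = some i → 0 < w (Fin.last j) i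
  measurableSet_partner : ∀ (j : ℕ) (w : Fin (j + 1) → L → ℝ≥0) (o : Option L),
    MeasurableSet {ω | partner j w ω = o}

section Weight

variable {L : Type} [Fintype L] [DecidableEq L] {n : ℕ}

/-- The total weight, under free disposal, of the assignment `σ` of the online vertices to offline
vertices: every offline vertex contributes the largest weight among the online vertices matched to
it, and `0` if there is none. -/
def assignmentWeight (w : Fin n → L → ℝ≥0) (σ : Fin n → Option L) : ℝ≥0 :=
  ∑ i, (Finset.univ.filter fun j => σ j = some i).sup fun j => w j i

/-- The optimal total weight with hindsight. (Keeping only a heaviest edge at each offline vertex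
turns every assignment into a matching of the same weight, so this is also the maximum weight of a
bipartite matching.) -/
def optimalWeight (w : Fin n → L → ℝ≥0) : ℝ≥0 :=
  (Finset.univ : Finset (Fin n → Option L)).sup (assignmentWeight w)

end Weight

namespace OnlineMatching

variable {L Ω : Type} [MeasurableSpace Ω]

/-- The assignment produced by the algorithm on an instance with `n` online vertices. -/
def run (M : OnlineMatching L Ω) {n : ℕ} (w : Fin n → L → ℝ≥0) (ω : Ω) (j : Fin n) : Option L :=
  M.partner j (fun k => w (Fin.castLE (Nat.succ_le_of_lt j.isLt) k)) ω

/-- On every instance the expected total weight of the matching is at least `Γ` times the optimal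
total weight with hindsight. -/
def IsCompetitive [Fintype L] [DecidableEq L] (M : OnlineMatching L Ω) (μ : Measure Ω)
    (Γ : ℝ) : Prop :=
  ∀ (n : ℕ) (w : Fin n → L → ℝ≥0),
    Γ * (optimalWeight w : ℝ) ≤ ∫ ω, (assignmentWeight w (M.run w ω) : ℝ) ∂μ

end OnlineMatching

/-- There is a `Γ`-competitive algorithm for edge-weighted online bipartite matching: for every
finite set of offline vertices there is a randomized online matching algorithm whose expected
weight is, on every instance, at least `Γ` times the optimum. -/
def ExistsCompetitiveMatching (Γ : ℝ) : Prop :=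
  ∀ (L : Type) [Fintype L] [DecidableEq L],
    ∃ (Ω : Type) (_ : MeasurableSpace Ω) (μ : Measure Ω) (_ : IsProbabilityMeasure μ)
      (M : OnlineMatching L Ω), M.IsCompetitive μ Γ

/-- The `ℓ`-th discrete derivative of `F`, where `(Δ F) n = F (n + 1) - F n`. -/
def discreteDeriv (ℓ : ℕ) (F : ℕ → ℝ) : ℕ → ℝ :=
  (fwdDiff 1)^[ℓ] F

/-- Log-concavity of a sequence of nonnegative numbers. -/
def IsLogConcaveSeq (F : ℕ → ℝ) : Prop :=
  ∀ k, F k * F (k + 2) ≤ F (k + 1) ^ 2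

/-!
The proof is a primal-dual analysis of a greedy algorithm that lets the OCS choose among `m`
proposals.

*The algorithm.* Every online vertex hands out `m` slots one after the other, each to the highest
bidder among the offline vertices, or to a dummy that bids `0` (`slots`). The resulting multiset is
given to an OCS on `Option L`, and the online vertex is matched to the winner (`matchingOfOCS`).
A time step of dummies is inserted after each online vertex, so that every interval of online
vertices becomes an interval of at least two time steps.

*Levels.* The expected weight of an offline vertex `i` is the integral over `x > 0` of the
probability that `i` is matched with weight at least `x`. For fixed `x`, the proposals to `i` of
weight at least `x` form blocks, separated by proposals of smaller weight. If the closed blocks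
contribute the product `P` and the open block has `k` proposals, then the guarantee of the OCS bounds
the probability that `i` gets no weight of at least `x` by `P * F k`
(`measureReal_forall_lt_le_survivalBound`).

*Duals.* With `N` geometric, `P(N = n) = m ^ n / (m + 1) ^ (n + 1)`, let
`g k = F k - E[F (k + N)]`; then `g 0 = Γ`. The level `x` gets the dual value `Γ - P * g k`, the dual
value `α i` of `i` is the integral over all levels, and `i` bids `(Γ * w i - α i) / m`. Two facts
are needed: dual values never decrease, and in each slot the increase of
`∑ i, ∫ x, (1 - P * F k)` covers the increase of the dual values plus the winning bid
(`dualValue_cons_add_bid_le`). Then the winning bids of an online vertex `j` add up to some `β j` with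
`α i + β j ≥ Γ * w j i`, also for the final `α i`, and weak duality gives the competitive ratio `Γ`
(`mul_optimalWeight_le`).

*Why the gain sharing is possible.* At levels `x ≤ w` the covering is an identity, by the recursion
`(m + 1) * g k = m * (F k - F (k + 1) + g (k + 1))`. At levels `x > w` the block is closed, and
`(P, k)` becomes `(P * F k, 0)`. The dual value does not decrease, since `F k * g 0 ≤ g k` by
log-concavity of `F`. It may increase at most by the factor `(m + 1) / m`, which amounts to
`(m + 1) * g k ≤ Γ * (1 + m * F k)`. There is equality at `k = 0`, and the case `k = 1` is the bound
assumed on `m`. From there it propagates to all `k` if `g` is log-concave. With `u k = F k - F (k + 1)`,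
the conditions on third differences say that
`u (k + 2) * u l + u k * u (l + 2) ≤ 2 * u (k + 1) * u (l + 1)` for all `k` and `l`. This is bilinear
in `u`, so it is inherited by the discounted sum `g` of `u` (`logConcave_of_discounted_sum`).
All this is collected in `exists_isDualGap`.
-/

/-! ### The dual gap of a level -/

/-- The properties of the dual gap that the gain sharing needs. A weight level of an offline vertex
that has closed blocks with survival bound `P` and an open block with `k` proposals gets the dual
value `g 0 - P * g k`; here `F` is the survival bound of one block and `m` the number of slots. -/
structure IsDualGap (m : ℕ) (F g : ℕ → ℝ) : Prop where
  nonneg : ∀ k, 0 ≤ g k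
  succ_le : ∀ k, g (k + 1) ≤ g k
  /-- A proposal in the open block: the primal gain `F k - F (k + 1)` pays for the dual increase
  and for the bid `g k / m`. -/
  balance : ∀ k, (m + 1) * g k = m * (F k - F (k + 1) + g (k + 1))
  /-- Closing a block does not decrease the dual value. -/
  mul_le : ∀ k, F k * g 0 ≤ g k
  /-- Closing a block increases the dual value at most by the factor `(m + 1) / m`. -/
  close_le : ∀ k, (m + 1) * g k ≤ g 0 * (1 + m * F k)

theorem Nat.forall_of_forall_ge_of_succ {p : ℕ → Prop} {K : ℕ} (hge : ∀ k, K ≤ k → p k)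
    (hsucc : ∀ k, k < K → p (k + 1) → p k) (k : ℕ) : p k := by
  obtain h | h := le_total K k
  · exact hge k h
  · induction h using Nat.decreasingInduction with
    | self => exact hge K le_rfl
    | of_succ k hk ih => exact hsucc k hk ih

/-- The expectation of `F (k + N)` for a geometric random variable `N` with
`P(N = n) = m ^ n / (m + 1) ^ (n + 1)`, in closed form for a sequence `F` that is geometric with
ratio `1 - c` from `K` on. -/
noncomputable def geomMean (m K : ℕ) (c : ℝ) (F : ℕ → ℝ) (k : ℕ) : ℝ :=
  (∑ n ∈ Finset.range (K - k), (m : ℝ) ^ n / ((m : ℝ) + 1) ^ (n + 1) * F (k + n))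
    + ((m : ℝ) / ((m : ℝ) + 1)) ^ (K - k) * (1 / (1 + m * c)) * F (k + (K - k))

theorem geomMean_of_le {m K : ℕ} {c : ℝ} {F : ℕ → ℝ} {k : ℕ} (hk : K ≤ k) :
    geomMean m K c F k = 1 / (1 + m * c) * F k := by
  simp [geomMean, Nat.sub_eq_zero_of_le hk]

theorem geomMean_eq {m K : ℕ} {c : ℝ} {F : ℕ → ℝ} (hc : 0 ≤ c)
    (hgeom : ∀ k, K ≤ k → F (k + 1) = (1 - c) * F k) (k : ℕ) :
    (m + 1) * geomMean m K c F k = F k + m * geomMean m K c F (k + 1) := by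
  have hm : (m : ℝ) + 1 ≠ 0 := by positivity
  have hmc : (1 : ℝ) + m * c ≠ 0 := by positivity
  obtain h | h := le_or_gt K k
  · rw [geomMean_of_le h, geomMean_of_le (h.trans k.le_succ), hgeom k h]
    field_simp
    ring
  · obtain ⟨d, hd⟩ : ∃ d, K - k = d + 1 := ⟨K - k - 1, by omega⟩
    have hd' : K - (k + 1) = d := by omega
    have hs : ∀ n, k + 1 + n = k + (n + 1) := fun n => by omega
    simp only [geomMean, hd, hd', Finset.sum_range_succ', hs, mul_add, Finset.mul_sum]
    rw [add_comm (∑ i ∈ _, _), add_assoc]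
    congr 1
    · simp [hm]
    · congr 1
      · refine Finset.sum_congr rfl fun n _ => ?_
        field_simp
        ring
      · rw [pow_succ]
        field_simp

/-- Log-concavity passes from adjacent to distant indices. -/
theorem mul_succ_le_of_logConcave {g : ℕ → ℝ} (h0 : ∀ k, 0 ≤ g k) (hanti : ∀ k, g (k + 1) ≤ g k)
    (hlog : ∀ k, g k * g (k + 2) ≤ g (k + 1) ^ 2) (l k : ℕ) :
    g l * g (l + k + 1) ≤ g (l + 1) * g (l + k) := by
  induction k with
  | zero => exact (mul_comm _ _).le
  | succ k ih =>
    obtain h | h := (h0 (l + k + 1)).eq_or_lt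
    · have : g (l + (k + 1) + 1) = 0 :=
        le_antisymm ((hanti _).trans_eq (by rw [← add_assoc, ← h])) (h0 _)
      rw [this, mul_zero]
      exact mul_nonneg (h0 _) (h0 _)
    · have hpos : 0 < g (l + k) := h.trans_le (hanti _)
      refine le_of_mul_le_mul_right ?_ hpos
      calc g l * g (l + k + 2) * g (l + k) = g l * (g (l + k) * g (l + k + 2)) := by ring
        _ ≤ g l * g (l + k + 1) ^ 2 := mul_le_mul_of_nonneg_left (hlog _) (h0 _)
        _ = g l * g (l + k + 1) * g (l + k + 1) := by ring
        _ ≤ g (l + 1) * g (l + k) * g (l + k + 1) := mul_le_mul_of_nonneg_right ih (h0 _)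
        _ = g (l + 1) * g (l + k + 1) * g (l + k) := by ring

theorem le_mul_of_logConcave {F : ℕ → ℝ} (h0 : ∀ k, 0 ≤ F k) (hanti : ∀ k, F (k + 1) ≤ F k)
    (hlog : ∀ k, F k * F (k + 2) ≤ F (k + 1) ^ 2) (hF0 : F 0 = 1) (k n : ℕ) :
    F (k + n) ≤ F k * F n := by
  induction n with
  | zero => simp [hF0]
  | succ n ih =>
    obtain h | h := (h0 n).eq_or_lt
    · have h1 : F (k + n) ≤ 0 := by rw [← h, mul_zero] at ih; exact ih
      exact ((hanti _).trans h1).trans (mul_nonneg (h0 _) (h0 _))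
    · obtain h' | h' := (h0 (k + n)).eq_or_lt
      · exact ((hanti _).trans_eq h'.symm).trans (mul_nonneg (h0 _) (h0 _))
      · have hr : ∀ k, F n * F (n + k + 1) ≤ F (n + 1) * F (n + k) :=
          mul_succ_le_of_logConcave h0 hanti hlog n
        refine le_of_mul_le_mul_left ?_ h
        calc F n * F (k + (n + 1)) = F n * F (n + k + 1) := by congr 2; omega
          _ ≤ F (n + 1) * F (n + k) := hr k
          _ ≤ F (n + 1) * (F k * F n) := by
            rw [add_comm n k]; exact mul_le_mul_of_nonneg_left ih (h0 _)
          _ = F n * (F k * F (n + 1)) := by ring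

/-- A discounted sum `g` of a sequence `u` that satisfies
`u (k + 2) * u l + u k * u (l + 2) ≤ 2 * u (k + 1) * u (l + 1)` for *all* pairs `k`, `l` is
log-concave: the inequality is bilinear, so it passes to `g` in one argument after the other.
(Log-concavity of `u` alone would not be enough.) -/
theorem logConcave_of_discounted_sum {u g : ℕ → ℝ} {θ lam : ℝ} {K : ℕ} (hθ : 0 ≤ θ)
    (hlam : 0 ≤ lam) (hrec : ∀ k, g k = θ * (u k + g (k + 1))) (htail : ∀ k, K ≤ k → g k = lam * u k)
    (hu : ∀ k l, u (k + 2) * u l + u k * u (l + 2) ≤ 2 * (u (k + 1) * u (l + 1))) (k : ℕ) :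
    g k * g (k + 2) ≤ g (k + 1) ^ 2 := by
  have key : ∀ v : ℕ → ℝ, ∀ l,
      (∀ k, u (k + 2) * v l + u k * v (l + 2) ≤ 2 * (u (k + 1) * v (l + 1))) →
      ∀ k, g (k + 2) * v l + g k * v (l + 2) ≤ 2 * (g (k + 1) * v (l + 1)) := by
    intro v l hv
    refine Nat.forall_of_forall_ge_of_succ (K := K) (fun k hk => ?_) (fun k _ ih => ?_)
    · rw [htail k hk, htail (k + 1) (by omega), htail (k + 2) (by omega)]
      nlinarith [mul_le_mul_of_nonneg_left (hv k) hlam]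
    · calc g (k + 2) * v l + g k * v (l + 2)
          = θ * (u (k + 2) + g (k + 1 + 2)) * v l + θ * (u k + g (k + 1)) * v (l + 2) := by
            rw [← hrec k, ← hrec (k + 2)]
        _ = θ * (u (k + 2) * v l + u k * v (l + 2)
              + (g (k + 1 + 2) * v l + g (k + 1) * v (l + 2))) := by ring
        _ ≤ θ * (2 * (u (k + 1) * v (l + 1)) + 2 * (g (k + 1 + 1) * v (l + 1))) :=
            mul_le_mul_of_nonneg_left (add_le_add (hv k) ih) hθ
        _ = 2 * (θ * (u (k + 1) + g (k + 1 + 1)) * v (l + 1)) := by ring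
        _ = 2 * (g (k + 1) * v (l + 1)) := by rw [← hrec (k + 1)]
  have h1 := fun l k => key u l (fun k => hu k l) k
  have h2 := key g k (fun l => by linarith [h1 l k]) k
  linarith

theorem discreteDeriv_one (F : ℕ → ℝ) (k : ℕ) : discreteDeriv 1 F k = F (k + 1) - F k := rfl

theorem discreteDeriv_two (F : ℕ → ℝ) (k : ℕ) :
    discreteDeriv 2 F k = F (k + 2) - 2 * F (k + 1) + F k := by
  simp only [discreteDeriv, Function.iterate_succ, Function.iterate_zero, Function.comp, id,
    fwdDiff]
  ring_nf

theorem discreteDeriv_three (F : ℕ → ℝ) (k : ℕ) :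
    discreteDeriv 3 F k = F (k + 3) - 3 * F (k + 2) + 3 * F (k + 1) - F k := by
  simp only [discreteDeriv, Function.iterate_succ, Function.iterate_zero, Function.comp, id,
    fwdDiff]
  ring_nf

/-- The sequence `g k = F k - E[F (k + N)]`, with `N` geometric, is a dual gap. The conditions on
the differences of `F` make `g` log-concave, which reduces the bound on closing a block to the
block of length one. -/
theorem exists_isDualGap {m kstar : ℕ} {c : ℝ} (hc : c ∈ Set.Icc (0 : ℝ) 1)
    {F : ℕ → ℝ} (hF : ∀ k, F k ∈ Set.Icc (0 : ℝ) 1) (hF_log : IsLogConcaveSeq F)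
    (hF_geom : ∀ k, kstar ≤ k → F k = F kstar * (1 - c) ^ (k - kstar))
    (hF_convex : ∀ k, k < kstar → 0 ≤ discreteDeriv 2 F k)
    (hF_third : ∀ k₁ k₂, k₁ < kstar → k₂ < kstar →
      discreteDeriv 3 F k₁ * discreteDeriv 1 F k₂ + discreteDeriv 1 F k₁ * discreteDeriv 3 F k₂ ≤
        2 * (discreteDeriv 2 F k₁ * discreteDeriv 2 F k₂))
    (hF_third_c : ∀ k, k < kstar →
      0 ≤ discreteDeriv 3 F k + 2 * c * discreteDeriv 2 F k + c ^ 2 * discreteDeriv 1 F k)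
    {Γ : ℝ}
    (hΓ : Γ = 1 - (∑ n ∈ Finset.range kstar, (m : ℝ) ^ n / ((m : ℝ) + 1) ^ (n + 1) * F n)
      - ((m : ℝ) / ((m : ℝ) + 1)) ^ kstar * (1 / (1 + m * c)) * F kstar)
    (hm : Γ + (1 - Γ) * (m * discreteDeriv 1 F 0) ≠ 0 →
      (m : ℝ) ≤ (-(m * discreteDeriv 1 F 0) - Γ) / (Γ + (1 - Γ) * (m * discreteDeriv 1 F 0)))
    (hm0 : 0 < m) (hF0 : F 0 = 1) : ∃ g, g 0 = Γ ∧ IsDualGap m F g := by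
  obtain ⟨hc0, hc1⟩ := hc
  have hm0' : (0 : ℝ) < m := Nat.cast_pos.2 hm0
  have hmc : (0 : ℝ) < 1 + m * c := by positivity
  have hstep : ∀ k, kstar ≤ k → F (k + 1) = (1 - c) * F k := by
    intro k hk
    rw [hF_geom k hk, hF_geom (k + 1) (by omega), Nat.sub_add_comm hk, pow_succ]
    ring
  set u : ℕ → ℝ := fun k => F k - F (k + 1) with hu
  have hu_tail : ∀ k, kstar ≤ k → u k = c * F k := fun k hk => by
    simp only [hu, hstep k hk]; ring
  have hu_step : ∀ k, kstar ≤ k → u (k + 1) = (1 - c) * u k := fun k hk => by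
    rw [hu_tail k hk, hu_tail (k + 1) (by omega), hstep k hk]; ring
  have hu_anti_lt : ∀ k, k < kstar → u (k + 1) ≤ u k := fun k hk => by
    have := hF_convex k hk
    rw [discreteDeriv_two] at this
    simp only [hu]; linarith
  have hu0 : ∀ k, 0 ≤ u k := by
    refine Nat.forall_of_forall_ge_of_succ (K := kstar) (fun k hk => ?_) (fun k hk ih => ?_)
    · rw [hu_tail k hk]; exact mul_nonneg hc0 (hF k).1
    · exact ih.trans (hu_anti_lt k hk)
  have hu_anti : ∀ k, u (k + 1) ≤ u k := fun k => by
    obtain hk | hk := le_or_gt kstar k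
    · rw [hu_step k hk]; nlinarith [hu0 k]
    · exact hu_anti_lt k hk
  have hF_anti : ∀ k, F (k + 1) ≤ F k := fun k => sub_nonneg.1 (hu0 k)
  -- The two conditions on third differences, together with the geometric tail, are the
  -- bilinear inequality for all pairs of indices.
  have hu_lt_ge : ∀ k l, k < kstar → kstar ≤ l →
      u (k + 2) * u l + u k * u (l + 2) ≤ 2 * (u (k + 1) * u (l + 1)) := by
    intro k l hk hl
    have h := hF_third_c k hk
    rw [discreteDeriv_one, discreteDeriv_two, discreteDeriv_three] at h
    have h' : 0 ≤ -(u (k + 2) - 2 * (1 - c) * u (k + 1) + (1 - c) ^ 2 * u k) := by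
      simp only [hu]; linarith
    rw [hu_step (l + 1) (by omega), hu_step l hl]
    nlinarith [mul_nonneg h' (hu0 l)]
  have hu_bilin : ∀ k l, u (k + 2) * u l + u k * u (l + 2) ≤ 2 * (u (k + 1) * u (l + 1)) := by
    intro k l
    obtain hk | hk := le_or_gt kstar k <;> obtain hl | hl := le_or_gt kstar l
    · rw [hu_step (l + 1) (by omega), hu_step l hl, hu_step (k + 1) (by omega), hu_step k hk]
      exact le_of_eq (by ring)
    · linarith [hu_lt_ge l k hl hk]
    · exact hu_lt_ge k l hk hl
    · have h := hF_third k l hk hl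
      simp only [discreteDeriv_one, discreteDeriv_two, discreteDeriv_three] at h
      simp only [hu]
      linarith
  set E := geomMean m kstar c F with hE
  have hErec := geomMean_eq (m := m) hc0 hstep
  rw [← hE] at hErec
  set g : ℕ → ℝ := fun k => F k - E k with hg
  have hg_bal : ∀ k, (m + 1) * g k = m * (u k + g (k + 1)) := fun k => by
    simp only [hg, hu]; linarith [hErec k]
  set θ : ℝ := m / (m + 1) with hθ
  have hθ0 : 0 ≤ θ := by positivity
  have hg_rec : ∀ k, g k = θ * (u k + g (k + 1)) := fun k => by
    have := hg_bal k
    rw [hθ]; field_simp; linarith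
  have hlam : (0 : ℝ) ≤ m / (1 + m * c) := by positivity
  have hg_tail : ∀ k, kstar ≤ k → g k = m / (1 + m * c) * u k := fun k hk => by
    simp only [hg, hE]
    rw [geomMean_of_le hk, hu_tail k hk]; field_simp; ring
  have hg_nonneg : ∀ k, 0 ≤ g k := by
    refine Nat.forall_of_forall_ge_of_succ (K := kstar) (fun k hk => ?_) (fun k hk ih => ?_)
    · rw [hg_tail k hk]; exact mul_nonneg hlam (hu0 k)
    · rw [hg_rec k]; exact mul_nonneg hθ0 (add_nonneg (hu0 k) ih)
  have hg_anti : ∀ k, g (k + 1) ≤ g k := by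
    refine Nat.forall_of_forall_ge_of_succ (K := kstar) (fun k hk => ?_) (fun k hk ih => ?_)
    · rw [hg_tail k hk, hg_tail (k + 1) (by omega)]
      exact mul_le_mul_of_nonneg_left (hu_anti k) hlam
    · have := mul_le_mul_of_nonneg_left (add_le_add (hu_anti k) ih) hθ0
      rwa [← hg_rec k, ← hg_rec (k + 1)] at this
  have hg_log := logConcave_of_discounted_sum hθ0 hlam hg_rec hg_tail hu_bilin
  have hg0 : g 0 = Γ := by
    simp only [hg, hE, geomMean, hΓ, hF0]; simp; ring
  have hsub := le_mul_of_logConcave (fun k => (hF k).1) hF_anti hF_log hF0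
  have hE_le : ∀ k n, E (k + n) ≤ F k * E n := fun k => by
    refine Nat.forall_of_forall_ge_of_succ (K := kstar) (fun n hn => ?_) (fun n hn ih => ?_)
    · rw [hE, geomMean_of_le hn, geomMean_of_le (by omega), mul_left_comm]
      exact mul_le_mul_of_nonneg_left (hsub k n) (by positivity)
    · have h1 := hErec (k + n)
      have h2 := hErec n
      rw [← add_assoc] at ih
      refine le_of_mul_le_mul_left (a := (m : ℝ) + 1) ?_ (by positivity)
      calc (m + 1) * E (k + n) = F (k + n) + m * E (k + n + 1) := h1
        _ ≤ F k * F n + m * (F k * E (n + 1)) :=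
            add_le_add (hsub k n) (mul_le_mul_of_nonneg_left ih hm0'.le)
        _ = F k * (F n + m * E (n + 1)) := by ring
        _ = (m + 1) * (F k * E n) := by rw [← h2]; ring
  have hΓ0 : 0 ≤ g 0 := hg_nonneg 0
  -- The bound on closing a block of length one.
  have hone : (m + 1) * (g 0 - g 1) ≥ m * (g 0 * u 0) := by
    have hd : discreteDeriv 1 F 0 = -u 0 := by rw [discreteDeriv_one]; simp [hu]
    rw [hd, ← hg0] at hm
    have h1 : g 0 ≤ m * u 0 := by nlinarith [hg_bal 0, hg_anti 0]
    have h2 : (m : ℝ) * (g 0 + (1 - g 0) * (m * -u 0)) ≤ m * u 0 - g 0 := by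
      obtain h | h := lt_or_ge 0 (g 0 + (1 - g 0) * (m * -u 0))
      · have := hm h.ne'
        rw [le_div_iff₀ h] at this
        linarith
      · nlinarith [mul_nonneg hm0'.le (neg_nonneg.2 h)]
    refine le_of_mul_le_mul_left (a := (m : ℝ)) ?_ hm0'
    nlinarith [hg_bal 0]
  have hinc : ∀ k, m * (g 0 * u k) ≤ (m + 1) * (g k - g (k + 1)) := fun k => by
    obtain h | h := (hu0 0).eq_or_lt
    · have : u k = 0 := le_antisymm (by
        rw [h]; exact antitone_nat_of_succ_le hu_anti (Nat.zero_le k)) (hu0 k)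
      rw [this]
      have := hg_anti k
      simp only [mul_zero]
      exact mul_nonneg (by positivity) (by linarith)
    · have hr := mul_succ_le_of_logConcave hg_nonneg hg_anti hg_log 0 k
      simp only [zero_add] at hr
      have hb0 := hg_bal 0
      have hbk := hg_bal k
      have hcmp : (g 0 - g 1) * u k ≤ (g k - g (k + 1)) * u 0 := by
        have e0 : m * u 0 = (m + 1) * g 0 - m * g 1 := by rw [hb0]; ring
        have ek : m * u k = (m + 1) * g k - m * g (k + 1) := by rw [hbk]; ring
        refine le_of_mul_le_mul_left (a := (m : ℝ)) ?_ hm0'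
        calc m * ((g 0 - g 1) * u k) = (g 0 - g 1) * (m * u k) := by ring
          _ ≤ (g k - g (k + 1)) * (m * u 0) := by rw [e0, ek]; linarith
          _ = _ := by ring
      refine le_of_mul_le_mul_right ?_ h
      have hA := mul_le_mul_of_nonneg_right hone (hu0 k)
      have hB := mul_le_mul_of_nonneg_left hcmp (show (0 : ℝ) ≤ m + 1 by positivity)
      calc m * (g 0 * u k) * u 0 = m * (g 0 * u 0) * u k := by ring
        _ ≤ (m + 1) * (g 0 - g 1) * u k := hA
        _ = (m + 1) * ((g 0 - g 1) * u k) := by ring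
        _ ≤ (m + 1) * ((g k - g (k + 1)) * u 0) := hB
        _ = _ := by ring
  refine ⟨g, hg0, hg_nonneg, hg_anti, hg_bal, fun k => ?_, fun k => ?_⟩
  · have := hE_le k 0
    simp only [hg, hF0, add_zero] at this ⊢
    linarith
  · induction k with
    | zero => rw [hF0]; linarith
    | succ k ih =>
      have := hinc k
      simp only [hu] at this
      linarith

/-! ### Weight levels of an offline vertex -/

/-- The state at the weight level `x` of an offline vertex which has been proposed with the weights
in the list (latest first). The proposals of weight at least `x` form blocks that are separated by
proposals of smaller weight. The state consists of the product of `F` over the sizes of the closed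
blocks, and the size of the open block. -/
noncomputable def levelState (F : ℕ → ℝ) : List ℝ≥0 → ℝ → ℝ × ℕ
  | [], _ => (1, 0)
  | w :: h, x =>
    if x ≤ w then ((levelState F h x).1, (levelState F h x).2 + 1)
    else ((levelState F h x).1 * F (levelState F h x).2, 0)

/-- The bound on the probability that an offline vertex is matched with no weight of at least `x`. -/
noncomputable def survivalBound (F : ℕ → ℝ) (h : List ℝ≥0) (x : ℝ) : ℝ :=
  (levelState F h x).1 * F (levelState F h x).2

/-- The dual value of the weight level `x` of an offline vertex. -/
noncomputable def dualDensity (F g : ℕ → ℝ) (h : List ℝ≥0) (x : ℝ) : ℝ :=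
  g 0 - (levelState F h x).1 * g (levelState F h x).2

/-- The dual value of an offline vertex: the integral over its weight levels. -/
noncomputable def dualValue (F g : ℕ → ℝ) (h : List ℝ≥0) : ℝ :=
  ∫ x in Set.Ioi (0 : ℝ), dualDensity F g h x

/-- The lower bound on the expected weight of an offline vertex. -/
noncomputable def primalValue (F : ℕ → ℝ) (h : List ℝ≥0) : ℝ :=
  ∫ x in Set.Ioi (0 : ℝ), (1 - survivalBound F h x)

section LevelState

variable {F g : ℕ → ℝ} {m : ℕ}

theorem measurable_levelState (h : List ℝ≥0) : Measurable (levelState F h) := by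
  induction h with
  | nil => exact measurable_const
  | cons w h ih =>
    have hF : Measurable F := measurable_from_nat
    exact Measurable.ite measurableSet_Iic
      (ih.fst.prodMk (Measurable.of_discrete (f := Nat.succ) |>.comp ih.snd))
      ((ih.fst.mul (hF.comp ih.snd)).prodMk measurable_const)

theorem levelState_fst_mem (hF : ∀ k, F k ∈ Set.Icc (0 : ℝ) 1) (h : List ℝ≥0) (x : ℝ) :
    (levelState F h x).1 ∈ Set.Icc (0 : ℝ) 1 := by
  induction h with
  | nil => simp [levelState]
  | cons w h ih =>
    rw [levelState]
    split_ifs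
    · exact ih
    · exact ⟨mul_nonneg ih.1 (hF _).1, mul_le_one₀ ih.2 (hF _).1 (hF _).2⟩

theorem levelState_of_forall_lt (hF0 : F 0 = 1) {h : List ℝ≥0} {x : ℝ} (hx : ∀ w ∈ h, (w : ℝ) < x) :
    levelState F h x = (1, 0) := by
  induction h with
  | nil => rfl
  | cons w h ih =>
    rw [List.forall_mem_cons] at hx
    simp [levelState, ih hx.2, hF0, hx.1]

theorem levelState_replicate_append_of_le {h : List ℝ≥0} {w : ℝ≥0} {x : ℝ} (hx : x ≤ w) (t : ℕ) :
    levelState F (List.replicate t w ++ h) x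
      = ((levelState F h x).1, (levelState F h x).2 + t) := by
  induction t with
  | zero => rfl
  | succ t ih => rw [List.replicate_succ, List.cons_append, levelState, if_pos hx, ih]; rfl

/-- Proposing a smaller weight several times in a row closes one block only. -/
theorem levelState_replicate_append_of_lt (hF0 : F 0 = 1) {h : List ℝ≥0} {w : ℝ≥0} {x : ℝ}
    (hx : (w : ℝ) < x) (t : ℕ) :
    levelState F (List.replicate (t + 1) w ++ h) x = (survivalBound F h x, 0) := by
  induction t with
  | zero =>
    simp [levelState, hx, survivalBound]
  | succ t ih =>
    rw [List.replicate_succ, List.cons_append, levelState, if_neg hx.not_ge, ih]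
    simp [hF0]

theorem integrableOn_levelState (hF0 : F 0 = 1) (h : List ℝ≥0) {φ : ℝ × ℕ → ℝ} (hφ : Measurable φ)
    (h0 : φ (1, 0) = 0) {C : ℝ} (hC : ∀ x, |φ (levelState F h x)| ≤ C) :
    IntegrableOn (fun x => φ (levelState F h x)) (Set.Ioi 0) := by
  obtain ⟨B, hB0, hB⟩ : ∃ B : ℝ, 0 ≤ B ∧ ∀ w ∈ h, (w : ℝ) ≤ B :=
    ⟨(h.map NNReal.toReal).sum,
      List.sum_nonneg (by simp), fun w hw => List.single_le_sum (by simp) _ (List.mem_map_of_mem hw)⟩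
  rw [← Set.Ioc_union_Ioi_eq_Ioi hB0]
  refine IntegrableOn.union ?_ ?_
  · exact Measure.integrableOn_of_bounded (M := C) (by simp)
      (hφ.comp (measurable_levelState h)).aestronglyMeasurable (Filter.Eventually.of_forall hC)
  · refine (integrableOn_congr_fun (g := fun _ => (0 : ℝ)) (fun x hx => ?_) measurableSet_Ioi).2
      integrableOn_zero
    show φ (levelState F h x) = 0
    rw [levelState_of_forall_lt hF0 fun w hw => (hB w hw).trans_lt hx, h0]

theorem integrableOn_one_sub_survivalBound (hF : ∀ k, F k ∈ Set.Icc (0 : ℝ) 1) (hF0 : F 0 = 1)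
    (h : List ℝ≥0) : IntegrableOn (fun x => 1 - survivalBound F h x) (Set.Ioi 0) := by
  have hFm : Measurable F := measurable_from_nat
  refine integrableOn_levelState hF0 h (φ := fun s => 1 - s.1 * F s.2) (by fun_prop)
    (by simp [hF0]) (C := 1) fun x => ?_
  have h1 := levelState_fst_mem hF h x
  have h2 := hF (levelState F h x).2
  have h3 := mul_nonneg h1.1 h2.1
  have h4 := mul_le_one₀ h1.2 h2.1 h2.2
  exact abs_le.2 ⟨by linarith, by linarith⟩

theorem IsDualGap.le_zero (hg : IsDualGap m F g) (k : ℕ) : g k ≤ g 0 :=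
  antitone_nat_of_succ_le hg.succ_le (Nat.zero_le k)

theorem integrableOn_dualDensity (hF : ∀ k, F k ∈ Set.Icc (0 : ℝ) 1) (hF0 : F 0 = 1)
    (hg : IsDualGap m F g) (h : List ℝ≥0) : IntegrableOn (dualDensity F g h) (Set.Ioi 0) := by
  have hgm : Measurable g := measurable_from_nat
  refine integrableOn_levelState hF0 h (φ := fun s => g 0 - s.1 * g s.2) (by fun_prop)
    (by simp) (C := g 0) fun x => ?_
  have h1 := levelState_fst_mem hF h x
  have h2 := hg.nonneg (levelState F h x).2
  have h3 := mul_nonneg h1.1 h2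
  have h4 := mul_le_of_le_one_left h2 h1.2
  have h5 := hg.le_zero (levelState F h x).2
  exact abs_le.2 ⟨by linarith [hg.nonneg 0], by linarith⟩

theorem dualDensity_le_cons (hF : ∀ k, F k ∈ Set.Icc (0 : ℝ) 1) (hg : IsDualGap m F g)
    (h : List ℝ≥0) (w : ℝ≥0) (x : ℝ) : dualDensity F g h x ≤ dualDensity F g (w :: h) x := by
  have h1 := (levelState_fst_mem hF h x).1
  rw [dualDensity, dualDensity, levelState]
  split_ifs
  · exact sub_le_sub_left (mul_le_mul_of_nonneg_left (hg.succ_le _) h1) _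
  · rw [mul_assoc]
    exact sub_le_sub_left (mul_le_mul_of_nonneg_left (hg.mul_le _) h1) _

theorem dualValue_le_cons (hF : ∀ k, F k ∈ Set.Icc (0 : ℝ) 1) (hF0 : F 0 = 1)
    (hg : IsDualGap m F g) (h : List ℝ≥0) (w : ℝ≥0) :
    dualValue F g h ≤ dualValue F g (w :: h) :=
  integral_mono (integrableOn_dualDensity hF hF0 hg h) (integrableOn_dualDensity hF hF0 hg _)
    (dualDensity_le_cons hF hg h w)

theorem dualValue_nil : dualValue F g [] = 0 := by simp [dualValue, dualDensity, levelState]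

theorem primalValue_nil (hF0 : F 0 = 1) : primalValue F [] = 0 := by
  simp [primalValue, survivalBound, levelState, hF0]

theorem dualValue_nonneg (hF : ∀ k, F k ∈ Set.Icc (0 : ℝ) 1) (hF0 : F 0 = 1)
    (hg : IsDualGap m F g) (h : List ℝ≥0) : 0 ≤ dualValue F g h := by
  induction h with
  | nil => exact dualValue_nil.ge
  | cons w h ih => exact ih.trans (dualValue_le_cons hF hF0 hg h w)

/-- Gain sharing at a single weight level. -/
theorem dualDensity_cons_add_bid_le (hm : 0 < m) (hF : ∀ k, F k ∈ Set.Icc (0 : ℝ) 1)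
    (hF0 : F 0 = 1) (hg : IsDualGap m F g) (h : List ℝ≥0) (w : ℝ≥0) (x : ℝ) :
    dualDensity F g (w :: h) x - dualDensity F g h x
        + (g 0 * (Set.Iic (w : ℝ)).indicator (fun _ => 1) x - dualDensity F g h x) / m
      ≤ (1 - survivalBound F (w :: h) x) - (1 - survivalBound F h x) := by
  have hm' : (0 : ℝ) < m := Nat.cast_pos.2 hm
  obtain ⟨h0, h1⟩ := levelState_fst_mem hF h x
  simp only [dualDensity, survivalBound, levelState]
  rw [← le_sub_iff_add_le', div_le_iff₀ hm']
  generalize levelState F h x = s at *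
  obtain ⟨p, k⟩ := s
  split_ifs with hx
  · have := congrArg (p * ·) (hg.balance k)
    rw [Set.indicator_of_mem (Set.mem_Iic.2 hx)]
    linarith
  · have h3 := mul_le_mul_of_nonneg_left (hg.close_le k) h0
    have h4 := mul_nonneg (sub_nonneg.2 h1) (hg.nonneg 0)
    rw [Set.indicator_of_notMem (by simpa using hx)]
    rw [hF0]
    linarith

/-- Gain sharing: when an offline vertex is proposed with weight `w`, the gain of the primal value
pays for the increase of its dual value and for its bid `(g 0 * w - dualValue F g h) / m`. -/
theorem dualValue_cons_add_bid_le (hm : 0 < m) (hF : ∀ k, F k ∈ Set.Icc (0 : ℝ) 1)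
    (hF0 : F 0 = 1) (hg : IsDualGap m F g) (h : List ℝ≥0) (w : ℝ≥0) :
    dualValue F g (w :: h) - dualValue F g h + (g 0 * w - dualValue F g h) / m
      ≤ primalValue F (w :: h) - primalValue F h := by
  have hd := integrableOn_dualDensity hF hF0 hg
  have hp := integrableOn_one_sub_survivalBound hF hF0
  have hi : IntegrableOn ((Set.Iic (w : ℝ)).indicator fun _ => (1 : ℝ)) (Set.Ioi 0) := by
    rw [IntegrableOn, integrable_indicator_iff measurableSet_Iic, IntegrableOn,
      Measure.restrict_restrict measurableSet_Iic, Set.Iic_inter_Ioi]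
    exact integrableOn_const (by simp)
  have hw : ∫ x in Set.Ioi (0 : ℝ), (Set.Iic (w : ℝ)).indicator (fun _ => (1 : ℝ)) x = w := by
    rw [integral_indicator measurableSet_Iic, Measure.restrict_restrict measurableSet_Iic,
      Set.Iic_inter_Ioi]
    simp
  have hincr : IntegrableOn (fun x => dualDensity F g (w :: h) x - dualDensity F g h x)
      (Set.Ioi 0) := (hd _).sub (hd _)
  have hbid : IntegrableOn (fun x => (g 0 * (Set.Iic (w : ℝ)).indicator (fun _ => 1) x
      - dualDensity F g h x) / m) (Set.Ioi 0) := ((hi.const_mul _).sub (hd _)).div_const _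
  have key := integral_mono (hincr.add hbid) ((hp (w :: h)).sub (hp h))
    (dualDensity_cons_add_bid_le hm hF hF0 hg h w)
  simp only [Pi.add_apply, Pi.sub_apply] at key
  rw [integral_add hincr hbid,
    integral_sub (hd _) (hd _), integral_div, integral_sub (hi.const_mul _) (hd _),
    integral_const_mul, hw, integral_sub (hp _) (hp _)] at key
  exact key

end LevelState

/-! ### The proposals -/

section Proposals

variable {L : Type}

/-- `m` times the bid of an offline vertex of the given proposal history for the current slot; the
dummy element `none` bids `0`. -/
noncomputable def scaledBid (F g : ℕ → ℝ) (w : L → ℝ≥0) (H : L → List ℝ≥0) (o : Option L) : ℝ :=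
  o.elim 0 fun i => g 0 * w i - dualValue F g (H i)

/-- The highest bidder. -/
noncomputable def bestBidder [Finite L] (F g : ℕ → ℝ) (w : L → ℝ≥0) (H : L → List ℝ≥0) :
    Option L :=
  (Finite.exists_max (scaledBid F g w H)).choose

theorem scaledBid_le_bestBidder [Finite L] (F g : ℕ → ℝ) (w : L → ℝ≥0) (H : L → List ℝ≥0)
    (o : Option L) : scaledBid F g w H o ≤ scaledBid F g w H (bestBidder F g w H) :=
  (Finite.exists_max (scaledBid F g w H)).choose_spec o

/-- The weights of finitely many online vertices, followed by vertices without edges. -/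
def extendWeights {n : ℕ} (w : Fin n → L → ℝ≥0) (k : ℕ) : L → ℝ≥0 :=
  if h : k < n then w ⟨k, h⟩ else 0

theorem extendWeights_fin {n : ℕ} (w : Fin n → L → ℝ≥0) (j : Fin n) :
    extendWeights w j = w j := by simp [extendWeights]

variable [DecidableEq L]

/-- The proposal histories after a proposal to `o`. -/
def propose (w : L → ℝ≥0) (o : Option L) (H : L → List ℝ≥0) (i : L) : List ℝ≥0 :=
  if o = some i then w i :: H i else H i

theorem dualValue_le_propose {F g : ℕ → ℝ} {m : ℕ} (hF : ∀ k, F k ∈ Set.Icc (0 : ℝ) 1) (hF0 : F 0 = 1)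
    (hg : IsDualGap m F g) (w : L → ℝ≥0) (H : L → List ℝ≥0) (o : Option L) (i : L) :
    dualValue F g (H i) ≤ dualValue F g (propose w o H i) := by
  rw [propose]
  split_ifs
  · exact dualValue_le_cons hF hF0 hg _ _
  · exact le_rfl

variable [Finite L]

/-- The first `s` slots of an online vertex with weights `w` are given to the highest bidders, one
after the other: the proposal histories after these slots, and the multiset of the proposals. -/
noncomputable def slots (F g : ℕ → ℝ) (w : L → ℝ≥0) (H : L → List ℝ≥0) :
    (s : ℕ) → (L → List ℝ≥0) × Sym (Option L) s
  | 0 => (H, Sym.nil)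
  | s + 1 =>
    (propose w (bestBidder F g w (slots F g w H s).1) (slots F g w H s).1,
      bestBidder F g w (slots F g w H s).1 ::ₛ (slots F g w H s).2)

/-- The proposal histories before the arrival of an online vertex. -/
noncomputable def history (F g : ℕ → ℝ) (m : ℕ) (W : ℕ → L → ℝ≥0) : ℕ → L → List ℝ≥0
  | 0 => fun _ => []
  | n + 1 => (slots F g (W n) (history F g m W n) m).1

/-- The multiset of the proposals of an online vertex. -/
noncomputable def proposals (F g : ℕ → ℝ) (m : ℕ) (W : ℕ → L → ℝ≥0) (n : ℕ) : Sym (Option L) m :=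
  (slots F g (W n) (history F g m W n) m).2

theorem slots_fst_apply (F g : ℕ → ℝ) (w : L → ℝ≥0) (H : L → List ℝ≥0) (s : ℕ) (i : L) :
    (slots F g w H s).1 i =
      List.replicate (Multiset.count (some i) ((slots F g w H s).2 : Multiset (Option L))) (w i)
        ++ H i := by
  induction s with
  | zero => simp [slots]
  | succ s ih =>
    simp only [slots, propose, Sym.coe_cons, Multiset.count_cons]
    by_cases h : bestBidder F g w (slots F g w H s).1 = some i
    · rw [if_pos h, if_pos h.symm, List.replicate_succ, List.cons_append, ih]
    · rw [if_neg h, if_neg (Ne.symm h), add_zero, ih]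

theorem history_succ_apply (F g : ℕ → ℝ) (m : ℕ) (W : ℕ → L → ℝ≥0) (n : ℕ) (i : L) :
    history F g m W (n + 1) i =
      List.replicate
        (Multiset.count (some i) (proposals F g m W n : Multiset (Option L))) (W n i)
        ++ history F g m W n i :=
  slots_fst_apply ..

theorem history_congr (F g : ℕ → ℝ) (m : ℕ) {W W' : ℕ → L → ℝ≥0} {n : ℕ}
    (h : ∀ k < n, W k = W' k) : history F g m W n = history F g m W' n := by
  induction n with
  | zero => rfl
  | succ n ih =>
    rw [history, history, ih fun k hk => h k (by omega), h n (by omega)]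

theorem proposals_congr (F g : ℕ → ℝ) (m : ℕ) {W W' : ℕ → L → ℝ≥0} {n : ℕ}
    (h : ∀ k ≤ n, W k = W' k) : proposals F g m W n = proposals F g m W' n := by
  rw [proposals, proposals, history_congr F g m fun k hk => h k hk.le, h n le_rfl]

end Proposals

section Duality

variable {L : Type} [Fintype L] [DecidableEq L] {F g : ℕ → ℝ} {m : ℕ}

theorem sum_dualValue_propose_add_bid_le (hm : 0 < m) (hF : ∀ k, F k ∈ Set.Icc (0 : ℝ) 1)
    (hF0 : F 0 = 1) (hg : IsDualGap m F g) (w : L → ℝ≥0) (H : L → List ℝ≥0) (o : Option L) :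
    ∑ i, dualValue F g (propose w o H i) - ∑ i, dualValue F g (H i) + scaledBid F g w H o / m
      ≤ ∑ i, primalValue F (propose w o H i) - ∑ i, primalValue F (H i) := by
  cases o with
  | none => simp [propose, scaledBid]
  | some a =>
    rw [← Finset.sum_sub_distrib, ← Finset.sum_sub_distrib,
      Finset.sum_eq_single a (fun i _ hi => by simp [propose, hi.symm]) (by simp),
      Finset.sum_eq_single a (fun i _ hi => by simp [propose, hi.symm]) (by simp)]
    simpa [propose, scaledBid] using dualValue_cons_add_bid_le hm hF hF0 hg (H a) (w a)

/-- The dual value `β` of an online vertex is the sum of the bids in its slots. Since the dual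
values of the offline vertices do not decrease, every offline vertex would still bid at most what
was bid in each slot. -/
theorem exists_dual_slots (hm : 0 < m) (hF : ∀ k, F k ∈ Set.Icc (0 : ℝ) 1)
    (hF0 : F 0 = 1) (hg : IsDualGap m F g) (w : L → ℝ≥0) (H : L → List ℝ≥0) (s : ℕ) :
    ∃ β : ℝ, 0 ≤ β ∧
      (∀ i, s * ((g 0 * w i - dualValue F g ((slots F g w H s).1 i)) / m) ≤ β) ∧
      (∀ i, dualValue F g (H i) ≤ dualValue F g ((slots F g w H s).1 i)) ∧
      ∑ i, dualValue F g ((slots F g w H s).1 i) - ∑ i, dualValue F g (H i) + β ≤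
        ∑ i, primalValue F ((slots F g w H s).1 i) - ∑ i, primalValue F (H i) := by
  have hm' : (0 : ℝ) < m := Nat.cast_pos.2 hm
  induction s with
  | zero => exact ⟨0, le_rfl, by simp, fun i => le_rfl, by simp [slots]⟩
  | succ s ih =>
    obtain ⟨β, h0, hβ, hmono, hsum⟩ := ih
    set H' := (slots F g w H s).1
    set o := bestBidder F g w H'
    have hs : (slots F g w H (s + 1)).1 = propose w o H' := rfl
    have hle := dualValue_le_propose hF hF0 hg w H' o
    have hbest := scaledBid_le_bestBidder F g w H'
    refine ⟨β + scaledBid F g w H' o / m, add_nonneg h0 (div_nonneg (hbest none) hm'.le),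
      fun i => ?_, fun i => ?_, ?_⟩
    · rw [hs]
      have h1 : (g 0 * w i - dualValue F g (propose w o H' i)) / m ≤
          (g 0 * w i - dualValue F g (H' i)) / m := by gcongr; exact hle i
      have h2 : (g 0 * w i - dualValue F g (H' i)) / m ≤ scaledBid F g w H' o / m := by
        gcongr; exact hbest (some i)
      have h3 := mul_le_mul_of_nonneg_left h1 (Nat.cast_nonneg (α := ℝ) s)
      push_cast
      linarith [hβ i]
    · rw [hs]; exact (hmono i).trans (hle i)
    · rw [hs]
      linarith [sum_dualValue_propose_add_bid_le hm hF hF0 hg w H' o]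

theorem exists_dual_history (hm : 0 < m) (hF : ∀ k, F k ∈ Set.Icc (0 : ℝ) 1)
    (hF0 : F 0 = 1) (hg : IsDualGap m F g) (W : ℕ → L → ℝ≥0) :
    ∃ β : ℕ → ℝ, (∀ j, 0 ≤ β j) ∧
      (∀ n, ∀ j < n, ∀ i, g 0 * W j i ≤ dualValue F g (history F g m W n i) + β j) ∧
      ∀ n, ∑ i, dualValue F g (history F g m W n i) + ∑ j ∈ Finset.range n, β j ≤
        ∑ i, primalValue F (history F g m W n i) := by
  have hm' : (m : ℝ) ≠ 0 := Nat.cast_ne_zero.2 hm.ne'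
  choose β h0 hβ hmono hsum using fun j =>
    exists_dual_slots hm hF hF0 hg (W j) (history F g m W j) m
  refine ⟨β, h0, fun n j hj i => ?_, fun n => ?_⟩
  · have h1 : dualValue F g (history F g m W (j + 1) i) ≤ dualValue F g (history F g m W n i) :=
      monotone_nat_of_le_succ (f := fun n => dualValue F g (history F g m W n i))
        (fun n => hmono n i) hj
    have h2 := hβ j i
    rw [mul_div_cancel₀ _ hm'] at h2
    change g 0 * W j i - dualValue F g (history F g m W (j + 1) i) ≤ β j at h2
    linarith
  · induction n with
    | zero => simp [history, dualValue_nil, primalValue_nil hF0]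
    | succ n ih =>
      have h := hsum n
      change ∑ i, dualValue F g (history F g m W (n + 1) i) - _ + _ ≤
        ∑ i, primalValue F (history F g m W (n + 1) i) - _ at h
      rw [Finset.sum_range_succ]
      linarith

/-- Weak duality. -/
theorem mul_optimalWeight_le (hm : 0 < m) (hF : ∀ k, F k ∈ Set.Icc (0 : ℝ) 1)
    (hF0 : F 0 = 1) (hg : IsDualGap m F g) {n : ℕ} (w : Fin n → L → ℝ≥0) :
    g 0 * optimalWeight w ≤
      ∑ i, primalValue F (history F g m (extendWeights w) n i) := by
  obtain ⟨β, h0, hβ, hsum⟩ := exists_dual_history hm hF hF0 hg (extendWeights w)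
  refine le_trans ?_ (hsum n)
  obtain ⟨σ, -, hσ⟩ := Finset.exists_mem_eq_sup Finset.univ Finset.univ_nonempty (assignmentWeight w)
  rw [optimalWeight, hσ, assignmentWeight, NNReal.coe_sum, Finset.mul_sum]
  have hi : ∀ i, g 0 * (((Finset.univ.filter fun j => σ j = some i).sup fun j => w j i : ℝ≥0) : ℝ)
      ≤ dualValue F g (history F g m (extendWeights w) n i)
        + ∑ j : Fin n, if σ j = some i then β j else 0 := by
    intro i
    rw [← Finset.sum_filter]
    obtain h | h := (Finset.univ.filter fun j => σ j = some i).eq_empty_or_nonempty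
    · simpa [h] using dualValue_nonneg hF hF0 hg _
    · obtain ⟨j, hj, hsup⟩ := Finset.exists_mem_eq_sup _ h fun j => w j i
      rw [hsup]
      have h1 := hβ n j j.isLt i
      rw [extendWeights_fin] at h1
      exact h1.trans (add_le_add le_rfl
        (Finset.single_le_sum (f := fun j : Fin n => β j) (fun j _ => h0 j) hj))
  refine (Finset.sum_le_sum fun i _ => hi i).trans ?_
  rw [Finset.sum_add_distrib, Finset.sum_comm, Finset.sum_range]
  refine add_le_add le_rfl (Finset.sum_le_sum fun j _ => ?_)
  cases hj : σ j with
  | none => simpa using h0 j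
  | some a => simp

end Duality

/-! ### The matching obtained from an OCS -/

namespace DiscreteOCS

variable {m : ℕ} {L Ω : Type} [MeasurableSpace Ω] {μ : Measure Ω} {F : ℕ → ℝ}

/-- The guarantee of an OCS for a list of disjoint time intervals, the latest first. -/
theorem HasGuarantee.list [DecidableEq L] {O : DiscreteOCS m L Ω} (hO : O.HasGuarantee μ F)
    (A : ℕ → Sym L m) (i : L) (bs : List (ℕ × ℕ)) (hlt : ∀ p ∈ bs, p.1 < p.2)
    (hbs : bs.Pairwise fun p q => q.2 < p.1) :
    μ.real {ω | ∀ p ∈ bs, ∀ j ∈ Finset.Icc p.1 p.2, O.run A j ω ≠ i} ≤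
      (bs.map fun p =>
        F (∑ j ∈ Finset.Icc p.1 p.2, Multiset.count i (A j : Multiset L))).prod := by
  have h := hO A i bs.length (fun ℓ => bs[ℓ].1) (fun ℓ => bs[ℓ].2)
    (fun ℓ => hlt _ (List.getElem_mem _)) (fun ℓ ℓ' hne => ?_)
  · refine le_of_eq_of_le ?_ (h.trans_eq (Fin.prod_univ_fun_getElem bs fun p =>
      F (∑ j ∈ Finset.Icc p.1 p.2, Multiset.count i (A j : Multiset L))))
    congr 1
    ext ω
    simp only [Set.mem_ofPred_eq]
    exact ⟨fun H ℓ => H _ (List.getElem_mem _), fun H p hp => by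
      obtain ⟨k, hk, rfl⟩ := List.getElem_of_mem hp
      exact H ⟨k, hk⟩⟩
  · have hd : ∀ k k' : Fin bs.length, k < k' → bs[k'].2 < bs[k].1 := fun k k' hk =>
      List.pairwise_iff_getElem.1 hbs k k' k.isLt k'.isLt hk
    rw [Finset.disjoint_left]
    intro j hj hj'
    rw [Finset.mem_Icc] at hj hj'
    obtain h | h := lt_or_gt_of_ne hne
    · have := hd _ _ h; omega
    · have := hd _ _ h; omega

theorem run_mem (O : DiscreteOCS m L Ω) (A : ℕ → Sym L m) (j : ℕ) (ω : Ω) : O.run A j ω ∈ A j :=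
  O.winner_mem j (fun k => A k) ω

theorem run_congr (O : DiscreteOCS m L Ω) {A A' : ℕ → Sym L m} {j : ℕ} (h : ∀ k ≤ j, A k = A' k)
    (ω : Ω) : O.run A j ω = O.run A' j ω := by
  unfold run
  congr 1
  exact funext fun k => h k (Nat.lt_succ_iff.1 k.isLt)

end DiscreteOCS

/-- An OCS needs at least one element to choose from. -/
theorem ExistsDiscreteOCS.pos {F : ℕ → ℝ} {m : ℕ} (h : ExistsDiscreteOCS F m) : 0 < m := by
  obtain ⟨Ω, _, μ, _, O, -⟩ := h Unit
  obtain ⟨ω⟩ := μ.nonempty_of_neZero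
  rcases Nat.eq_zero_or_pos m with rfl | hm
  · have := O.winner_mem 0 (fun _ => Sym.nil) ω
    simp at this
  · exact hm

/-- An element that never appears never wins. -/
theorem ExistsDiscreteOCS.one_le {F : ℕ → ℝ} {m : ℕ} (h : ExistsDiscreteOCS F m) : 1 ≤ F 0 := by
  obtain ⟨Ω, _, μ, _, O, hO⟩ := h Bool
  have h1 := hO (fun _ => Sym.replicate m true) false 1 (fun _ => 0) (fun _ => 1) (by simp)
    (fun ℓ ℓ' hne => (hne (Subsingleton.elim _ _)).elim)
  have h2 : ∀ j ω, O.run (fun _ => Sym.replicate m true) j ω ≠ false := fun j ω hj => by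
    have := O.run_mem (fun _ => Sym.replicate m true) j ω
    rw [hj, Sym.mem_replicate] at this
    exact absurd this.2 (by simp)
  simpa [h2, Multiset.count_replicate] using h1

section Stream

variable {L : Type} [Finite L] [DecidableEq L]

/-- The stream of multisets for the OCS on the ground set `Option L`. The online vertex `j` uses
the time step `2 * j`; the odd time steps are fillers, which make sure that every block of online
vertices corresponds to at least two time steps. -/
noncomputable def ocsStream (F g : ℕ → ℝ) (m : ℕ) (W : ℕ → L → ℝ≥0) (t : ℕ) : Sym (Option L) m :=
  if Even t then proposals F g m W (t / 2) else Sym.replicate m none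

theorem ocsStream_two_mul (F g : ℕ → ℝ) (m : ℕ) (W : ℕ → L → ℝ≥0) (n : ℕ) :
    ocsStream F g m W (2 * n) = proposals F g m W n := by simp [ocsStream]

theorem count_ocsStream_odd (F g : ℕ → ℝ) (m : ℕ) (W : ℕ → L → ℝ≥0) (n : ℕ) (i : L) :
    Multiset.count (some i) (ocsStream F g m W (2 * n + 1) : Multiset (Option L)) = 0 := by
  simp [ocsStream]

theorem ocsStream_congr (F g : ℕ → ℝ) (m : ℕ) {W W' : ℕ → L → ℝ≥0} {n : ℕ}
    (h : ∀ k ≤ n, W k = W' k) {t : ℕ} (ht : t ≤ 2 * n) :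
    ocsStream F g m W t = ocsStream F g m W' t := by
  unfold ocsStream
  rw [proposals_congr F g m fun k hk => h k (by omega)]

/-- The block structure behind `levelState`: before the online vertex `n`, the closed blocks at the
weight level `x` of `i` are the intervals in `bs` (the latest first), and the open block consists
of the time steps from `2 * s` on. In these time steps `i` is only proposed with weight at
least `x`. -/
theorem exists_blocks {F : ℕ → ℝ} (hF0 : F 0 = 1) (g : ℕ → ℝ) (m : ℕ) (W : ℕ → L → ℝ≥0) (i : L)
    (x : ℝ) (n : ℕ) :
    ∃ (bs : List (ℕ × ℕ)) (s : ℕ), s ≤ n ∧ (∀ p ∈ bs, p.1 < p.2 ∧ p.2 < 2 * s) ∧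
      (bs.Pairwise fun p q => q.2 < p.1) ∧
      levelState F (history F g m W n i) x =
        ((bs.map fun p => F (∑ t ∈ Finset.Icc p.1 p.2,
            Multiset.count (some i) (ocsStream F g m W t : Multiset (Option L)))).prod,
          ∑ t ∈ Finset.Ico (2 * s) (2 * n),
            Multiset.count (some i) (ocsStream F g m W t : Multiset (Option L))) ∧
      ∀ t, (t ∈ Finset.Ico (2 * s) (2 * n) ∨ ∃ p ∈ bs, t ∈ Finset.Icc p.1 p.2) →
        some i ∈ ocsStream F g m W t → Even t ∧ x ≤ W (t / 2) i := by
  induction n with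
  | zero => exact ⟨[], 0, le_rfl, by simp, by simp, rfl, by simp⟩
  | succ n ih =>
    obtain ⟨bs, s, hsn, hlt, hpw, hst, hmem⟩ := ih
    have hsum : ∑ t ∈ Finset.Ico (2 * s) (2 * (n + 1)),
          Multiset.count (some i) (ocsStream F g m W t : Multiset (Option L)) =
        (∑ t ∈ Finset.Ico (2 * s) (2 * n),
          Multiset.count (some i) (ocsStream F g m W t : Multiset (Option L))) +
        Multiset.count (some i) (proposals F g m W n : Multiset (Option L)) := by
      rw [mul_add_one, Finset.sum_Ico_succ_top (by omega), Finset.sum_Ico_succ_top (by omega),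
        count_ocsStream_odd, add_zero, ocsStream_two_mul]
    have hnotodd : some i ∉ ocsStream F g m W (2 * n + 1) := fun h =>
      (Multiset.count_pos.2 h).ne' (count_ocsStream_odd F g m W n i)
    rw [history_succ_apply]
    by_cases hextend : some i ∈ proposals F g m W n → x ≤ W n i
    · -- The open block goes on.
      refine ⟨bs, s, by omega, hlt, hpw, ?_, fun t ht hit => ?_⟩
      · rw [hsum]
        by_cases hx : x ≤ W n i
        · rw [levelState_replicate_append_of_le hx, hst]
        · have h0 : Multiset.count (some i) (proposals F g m W n : Multiset (Option L)) = 0 :=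
            Multiset.count_eq_zero.2 fun h => hx (hextend h)
          rw [h0, List.replicate_zero, List.nil_append, add_zero, hst]
      · by_cases ht' : t ∈ Finset.Ico (2 * s) (2 * n) ∨ ∃ p ∈ bs, t ∈ Finset.Icc p.1 p.2
        · exact hmem t ht' hit
        · rw [not_or, Finset.mem_Ico] at ht'
          have ht2 := ht.resolve_right ht'.2
          rw [Finset.mem_Ico] at ht2
          obtain rfl | rfl : t = 2 * n ∨ t = 2 * n + 1 := by omega
          · rw [ocsStream_two_mul] at hit
            exact ⟨even_two_mul n, by simpa using hextend hit⟩
          · exact (hnotodd hit).elim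
    · -- The open block is closed.
      rw [Classical.not_imp, not_le] at hextend
      obtain ⟨hin, hx⟩ := hextend
      obtain ⟨d, hd⟩ : ∃ d,
          Multiset.count (some i) (proposals F g m W n : Multiset (Option L)) = d + 1 :=
        Nat.exists_eq_succ_of_ne_zero (Multiset.count_pos.2 hin).ne'
      have hlev := levelState_replicate_append_of_lt hF0 (h := history F g m W n i) hx d
      rw [hd, hlev, survivalBound, hst]
      obtain rfl | hs := hsn.eq_or_lt
      · exact ⟨bs, s + 1, le_rfl, fun p hp => ⟨(hlt p hp).1, by have := (hlt p hp).2; omega⟩, hpw,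
          by simp [hF0], fun t ht hit => hmem t (Or.inr (ht.resolve_left (by simp))) hit⟩
      · have hIco : Finset.Ico (2 * s) (2 * n) = Finset.Icc (2 * s) (2 * n - 1) := by
          ext t; simp only [Finset.mem_Ico, Finset.mem_Icc]; omega
        refine ⟨(2 * s, 2 * n - 1) :: bs, n + 1, le_rfl, ?_, ?_, ?_, fun t ht hit => ?_⟩
        · rw [List.forall_mem_cons]
          exact ⟨by constructor <;> simp only <;> omega,
            fun p hp => ⟨(hlt p hp).1, by have := (hlt p hp).2; omega⟩⟩
        · exact List.pairwise_cons.2 ⟨fun p hp => (hlt p hp).2, hpw⟩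
        · simp only [List.map_cons, List.prod_cons, Finset.Ico_self, Finset.sum_empty, hIco]
          rw [mul_comm]
        · obtain ⟨p, hp, htp⟩ := ht.resolve_left (by simp)
          obtain rfl | hp := List.mem_cons.1 hp
          · exact hmem t (Or.inl (by rwa [hIco])) hit
          · exact hmem t (Or.inr ⟨p, hp, htp⟩) hit

/-- The probability that `i` wins no online vertex of weight at least `x` is at most the survival
bound. -/
theorem measureReal_forall_lt_le_survivalBound {m : ℕ} {Ω : Type} [MeasurableSpace Ω]
    {μ : Measure Ω} [IsFiniteMeasure μ] {F : ℕ → ℝ} (hF0 : F 0 = 1)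
    {O : DiscreteOCS m (Option L) Ω} (hO : O.HasGuarantee μ F) (g : ℕ → ℝ) (W : ℕ → L → ℝ≥0)
    (i : L) (x : ℝ) (n : ℕ) :
    μ.real {ω | ∀ j < n, O.run (ocsStream F g m W) (2 * j) ω = some i → (W j i : ℝ) < x} ≤
      survivalBound F (history F g m W n i) x := by
  obtain ⟨bs, s, hsn, hlt, hpw, hst, hmem⟩ := exists_blocks hF0 g m W i x n
  have hne : ∀ ω, (∀ j < n, O.run (ocsStream F g m W) (2 * j) ω = some i → (W j i : ℝ) < x) →
      ∀ t < 2 * n, (t ∈ Finset.Ico (2 * s) (2 * n) ∨ ∃ p ∈ bs, t ∈ Finset.Icc p.1 p.2) →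
        O.run (ocsStream F g m W) t ω ≠ some i := by
    intro ω hω t htn ht heq
    obtain ⟨⟨j, rfl⟩, hx⟩ := hmem t ht (heq ▸ O.run_mem _ t ω)
    rw [← two_mul] at heq hx htn
    rw [Nat.mul_div_cancel_left j two_pos] at hx
    exact (hω j (by omega) heq).not_ge hx
  rw [survivalBound, hst]
  obtain rfl | hs := hsn.eq_or_lt
  · refine (measureReal_mono fun ω hω p hp t ht => ?_).trans
      ((hO.list (ocsStream F g m W) (some i) bs (fun p hp => (hlt p hp).1) hpw).trans_eq
        (by simp [hF0]))
    exact hne ω hω t ((Finset.mem_Icc.1 ht).2.trans_lt (hlt p hp).2) (Or.inr ⟨p, hp, ht⟩)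
  · have hIco : Finset.Ico (2 * s) (2 * n) = Finset.Icc (2 * s) (2 * n - 1) := by
      ext t; simp only [Finset.mem_Ico, Finset.mem_Icc]; omega
    refine (measureReal_mono fun ω hω p hp t ht => ?_).trans
      ((hO.list (ocsStream F g m W) (some i) ((2 * s, 2 * n - 1) :: bs)
        (List.forall_mem_cons.2 ⟨by simp only; omega, fun p hp => (hlt p hp).1⟩)
        (List.pairwise_cons.2 ⟨fun p hp => (hlt p hp).2, hpw⟩)).trans_eq
        (by
          simp only [List.map_cons, List.prod_cons, hIco]
          exact mul_comm _ _))
    obtain rfl | hp := List.mem_cons.1 hp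
    · have h2 := Finset.mem_Icc.1 ht
      simp only at h2
      exact hne ω hω t (by omega) (Or.inl (by rwa [hIco]))
    · have := (hlt p hp).2
      have := (Finset.mem_Icc.1 ht).2
      exact hne ω hω t (by omega) (Or.inr ⟨p, hp, ht⟩)

end Stream

section Expectation

variable {L Ω : Type} [MeasurableSpace Ω]

/-- A comparison of an integral over levels with an expectation. -/
theorem setIntegral_Ioi_le_integral_of_le_measureReal {μ : Measure Ω} [IsFiniteMeasure μ]
    {f : Ω → ℝ} {M : ℝ} (hf : Integrable f μ) (h0 : ∀ ω, 0 ≤ f ω) (hM : ∀ ω, f ω ≤ M) {φ : ℝ → ℝ}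
    (hφ : IntegrableOn φ (Set.Ioi 0)) (hle : ∀ x, 0 < x → φ x ≤ μ.real {ω | x ≤ f ω}) :
    ∫ x in Set.Ioi (0 : ℝ), φ x ≤ ∫ ω, f ω ∂μ := by
  rw [hf.integral_eq_integral_meas_le (Filter.Eventually.of_forall h0)]
  refine setIntegral_mono_on hφ ?_ measurableSet_Ioi hle
  have hsub : Set.Ioi (0 : ℝ) ⊆ Set.Icc 0 M ∪ Set.Ioi M := fun x hx =>
    (le_or_gt x M).imp (fun h => ⟨le_of_lt hx, h⟩) id
  refine IntegrableOn.mono_set (IntegrableOn.union ?_ ?_) hsub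
  · exact AntitoneOn.integrableOn_isCompact isCompact_Icc fun x _ y _ hxy =>
      measureReal_mono fun ω hω => hxy.trans hω
  · refine (integrableOn_congr_fun (g := fun _ => (0 : ℝ)) (fun x hx => ?_) measurableSet_Ioi).2
      integrableOn_zero
    have : {ω | x ≤ f ω} = ∅ :=
      Set.eq_empty_of_forall_notMem fun ω hω => (hM ω).not_gt (lt_of_lt_of_le hx hω)
    simp [this]

variable [Finite L]

theorem measurable_of_run (M : OnlineMatching L Ω) {n : ℕ} (w : Fin n → L → ℝ≥0)
    (f : (Fin n → Option L) → ℝ) : Measurable fun ω => f (M.run w ω) := by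
  let _ : MeasurableSpace (Option L) := ⊤
  have h : Measurable fun ω => M.run w ω := measurable_pi_lambda _ fun j =>
    measurable_to_countable' fun o => M.measurableSet_partner j _ o
  exact (measurable_of_finite f).comp h

theorem integrable_of_run {μ : Measure Ω} [IsFiniteMeasure μ] (M : OnlineMatching L Ω) {n : ℕ}
    (w : Fin n → L → ℝ≥0) (f : (Fin n → Option L) → ℝ) : Integrable (fun ω => f (M.run w ω)) μ := by
  obtain ⟨C, hC⟩ := (Set.finite_range fun σ => ‖f σ‖).bddAbove
  exact Integrable.of_bound (measurable_of_run M w f).aestronglyMeasurable C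
    (Filter.Eventually.of_forall fun ω => hC ⟨_, rfl⟩)

end Expectation

/-- Every online vertex is matched to the winner of the OCS among its proposals, if the winner is
a neighbour. -/
noncomputable def matchingOfOCS {m : ℕ} {L Ω : Type} [Finite L] [DecidableEq L] [MeasurableSpace Ω]
    (O : DiscreteOCS m (Option L) Ω) (F g : ℕ → ℝ) : OnlineMatching L Ω where
  partner j w ω := (O.run (ocsStream F g m (extendWeights w)) (2 * j) ω).filter
    fun i => decide (0 < w (Fin.last j) i)
  edge j w ω i h := by
    have := (Option.filter_eq_some_iff.1 h).2
    simpa using this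
  measurableSet_partner j w o := by
    have : {ω | (O.run (ocsStream F g m (extendWeights w)) (2 * j) ω).filter
          (fun i => decide (0 < w (Fin.last j) i)) = o} =
        ⋃ o' ∈ {o' : Option L | o'.filter (fun i => decide (0 < w (Fin.last j) i)) = o},
          {ω | O.run (ocsStream F g m (extendWeights w)) (2 * j) ω = o'} := by
      ext ω; simp
    rw [this]
    exact MeasurableSet.biUnion (Set.toFinite _).countable fun o' _ => O.measurableSet_winner _ _ o'

section Matching

variable {L Ω : Type} [Fintype L] [DecidableEq L] [MeasurableSpace Ω] {m : ℕ}

theorem matchingOfOCS_run (O : DiscreteOCS m (Option L) Ω) (F g : ℕ → ℝ) {n : ℕ}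
    (w : Fin n → L → ℝ≥0) (ω : Ω) (j : Fin n) :
    (matchingOfOCS O F g).run w ω j =
      (O.run (ocsStream F g m (extendWeights w)) (2 * j) ω).filter
        fun i => decide (0 < w j i) := by
  have hW : ∀ k ≤ (j : ℕ), extendWeights
      (fun k : Fin (j + 1) => w (Fin.castLE (Nat.succ_le_of_lt j.isLt) k)) k =
        extendWeights w k := fun k hk => by
    simp only [extendWeights, dif_pos (Nat.lt_succ_of_le hk), dif_pos (hk.trans_lt j.isLt)]
    rfl
  have := O.run_congr (fun t ht => ocsStream_congr F g m hW ht) ω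
  simp only [OnlineMatching.run, matchingOfOCS, this]
  rfl

/-- The weight of the offline vertex `i` under the assignment `σ`. -/
noncomputable def vertexWeight {n : ℕ} (w : Fin n → L → ℝ≥0) (σ : Fin n → Option L) (i : L) : ℝ≥0 :=
  (Finset.univ.filter fun j => σ j = some i).sup fun j => w j i

theorem primalValue_le_integral_vertexWeight {μ : Measure Ω} [IsProbabilityMeasure μ]
    {F : ℕ → ℝ} (hF : ∀ k, F k ∈ Set.Icc (0 : ℝ) 1) (hF0 : F 0 = 1)
    {O : DiscreteOCS m (Option L) Ω} (hO : O.HasGuarantee μ F) (g : ℕ → ℝ) {n : ℕ}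
    (w : Fin n → L → ℝ≥0) (i : L) :
    primalValue F (history F g m (extendWeights w) n i) ≤
      ∫ ω, (vertexWeight w ((matchingOfOCS O F g).run w ω) i : ℝ) ∂μ := by
  set M := matchingOfOCS O F g
  refine setIntegral_Ioi_le_integral_of_le_measureReal
    (M := ((Finset.univ.sup fun j => w j i : ℝ≥0) : ℝ))
    (integrable_of_run M w fun σ => (vertexWeight w σ i : ℝ)) (fun ω => NNReal.coe_nonneg _)
    (fun ω => NNReal.coe_le_coe.2 (Finset.sup_mono (Finset.filter_subset _ _)))
    (integrableOn_one_sub_survivalBound hF hF0 _) fun x hx => ?_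
  have hms : MeasurableSet {ω | x ≤ (vertexWeight w (M.run w ω) i : ℝ)} :=
    measurableSet_le measurable_const (measurable_of_run M w fun σ => (vertexWeight w σ i : ℝ))
  have hcompl := probReal_compl_eq_one_sub (μ := μ) hms
  suffices h : μ.real {ω | x ≤ (vertexWeight w (M.run w ω) i : ℝ)}ᶜ ≤
      survivalBound F (history F g m (extendWeights w) n i) x by linarith
  refine (measureReal_mono fun ω hω j hj hwin => ?_).trans
    (measureReal_forall_lt_le_survivalBound hF0 hO g (extendWeights w) i x n)
  by_contra! hxj
  have hfin := extendWeights_fin w ⟨j, hj⟩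
  simp only at hfin
  rw [hfin] at hxj
  refine hω (hxj.trans (NNReal.coe_le_coe.2 ?_))
  refine Finset.le_sup (f := fun j => w j i) (Finset.mem_filter.2 ⟨Finset.mem_univ _, ?_⟩)
  rw [matchingOfOCS_run, hwin, Option.filter_eq_some_iff]
  exact ⟨rfl, by simpa using hx.trans_le hxj⟩

theorem isCompetitive_matchingOfOCS {μ : Measure Ω} [IsProbabilityMeasure μ] (hm : 0 < m)
    {F g : ℕ → ℝ} (hF : ∀ k, F k ∈ Set.Icc (0 : ℝ) 1) (hF0 : F 0 = 1) (hg : IsDualGap m F g)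
    {O : DiscreteOCS m (Option L) Ω} (hO : O.HasGuarantee μ F) :
    (matchingOfOCS O F g).IsCompetitive μ (g 0) := by
  intro n w
  refine (mul_optimalWeight_le hm hF hF0 hg w).trans ?_
  simp only [assignmentWeight, NNReal.coe_sum]
  change _ ≤ ∫ ω, ∑ i, (vertexWeight w ((matchingOfOCS O F g).run w ω) i : ℝ) ∂μ
  rw [integral_finsetSum _ fun i _ =>
    integrable_of_run _ w fun σ => (vertexWeight w σ i : ℝ)]
  exact Finset.sum_le_sum fun i _ => primalValue_le_integral_vertexWeight hF hF0 hO g w i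

end Matching

theorem mainTheorem9 (m kstar : ℕ) (c : ℝ) (hc : c ∈ Set.Icc (0 : ℝ) 1)
    (F : ℕ → ℝ) (hF : ∀ k, F k ∈ Set.Icc (0 : ℝ) 1) (hF_log : IsLogConcaveSeq F)
    (hF_geom : ∀ k, kstar ≤ k → F k = F kstar * (1 - c) ^ (k - kstar))
    (hF_convex : ∀ k, k < kstar → 0 ≤ discreteDeriv 2 F k)
    (hF_third : ∀ k₁ k₂, k₁ < kstar → k₂ < kstar →
      discreteDeriv 3 F k₁ * discreteDeriv 1 F k₂ + discreteDeriv 1 F k₁ * discreteDeriv 3 F k₂ ≤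
        2 * (discreteDeriv 2 F k₁ * discreteDeriv 2 F k₂))
    (hF_third_c : ∀ k, k < kstar →
      0 ≤ discreteDeriv 3 F k + 2 * c * discreteDeriv 2 F k + c ^ 2 * discreteDeriv 1 F k)
    (Γ : ℝ)
    (hΓ : Γ = 1 - (∑ n ∈ Finset.range kstar, (m : ℝ) ^ n / ((m : ℝ) + 1) ^ (n + 1) * F n)
      - ((m : ℝ) / ((m : ℝ) + 1)) ^ kstar * (1 / (1 + m * c)) * F kstar)
    (hm : Γ + (1 - Γ) * (m * discreteDeriv 1 F 0) ≠ 0 →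
      (m : ℝ) ≤ (-(m * discreteDeriv 1 F 0) - Γ) / (Γ + (1 - Γ) * (m * discreteDeriv 1 F 0)))
    (hOCS : ExistsDiscreteOCS F m) :
    ExistsCompetitiveMatching Γ := by
  have hm0 := hOCS.pos
  have hF0 : F 0 = 1 := le_antisymm (hF 0).2 hOCS.one_le
  obtain ⟨g, hg0, hg⟩ := exists_isDualGap hc hF hF_log hF_geom hF_convex hF_third hF_third_c hΓ hm
    hm0 hF0
  intro L _ _
  obtain ⟨Ω, _, μ, _, O, hO⟩ := hOCS (Option L)
  exact ⟨Ω, _, μ, inferInstance, matchingOfOCS O F g,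
    hg0 ▸ isCompetitive_matchingOfOCS hm0 hF hF0 hg hO⟩
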